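/- Let $G$ be an infinite compact abelian (Hausdorff) group with normalized Haar measure $m$ and dual group $\Gamma$ (the continuous homomorphisms from $G$ into the circle group). Consider the complex Banach spaces $C(G)$ (with the supremum norm) and $L^1(G) = L^1(G, m)$. For $f \in L^1(G)$ put $\hat f(\gamma) = \int_G f\,\overline{\gamma}\,dm$ and $\operatorname{spec} f = \{\gamma \in \Gamma : \hat f(\gamma) \neq 0\}$, and for $\Lambda \subset \Gamma$ let $$C_\Lambda(G) = \{f \in C(G) : \operatorname{spec} f \subset \Lambda\}, \qquad L^1_\Lambda(G) = \{f \in L^1(G) : \operatorname{spec} f \subset \Lambda\}.$$ A Banach space $X$ has the Daugavet property if $\|\mathrm{Id}_X + T\| = 1 + \|T\|$ for every bounded operator $T : X \to X$ of rank one. If $X$ has the Daugavet property and $E$ is a Banach space, a bounded operator $T : X \to E$ is narrow if for all $x, y \in X$ with $\|x\| = \|y\| = 1$, all $x^* \in X^*$ and all $\varepsilon > 0$ there is $z \in X$ with $\|z\| = 1$, $\|T(y - z)\| + |x^*(y - z)| \leq \varepsilon$ and $\|x + z\| \geq 2 - \varepsilon$. A closed subspace $Y$ of a Banach space $X$ with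 the Daugavet property is rich in $X$ if the quotient map $X \to X/Y$ is narrow. Proposition. Let $\Lambda$ be a subset of $\Gamma$. (a) If $C_\Theta(G)$ has the Daugavet property for every $\Theta$ with $\Lambda \subset \Theta \subset \Gamma$, then $C_\Lambda(G)$ is a rich subspace of $C(G)$. (b) If $L^1_\Theta(G)$ has the Daugavet property for every $\Theta$ with $\Lambda \subset \Theta \subset \Gamma$, then $L^1_\Lambda(G)$ is a rich subspace of $L^1(G)$. -/

import Mathlib

open MeasureTheory
open scoped ComplexConjugate

section BanachSpaces

/-- A normed space has the Daugavet property if every bounded operator `T` of rank one on it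
satisfies the Daugavet equation `‖Id + T‖ = 1 + ‖T‖`. -/
def HasDaugavetProperty (𝕜 : Type*) [RCLike 𝕜] (X : Type*) [NormedAddCommGroup X]
    [NormedSpace 𝕜 X] : Prop :=
  ∀ T : X →L[𝕜] X, LinearMap.rank (T : X →ₗ[𝕜] X) = 1 →
    ‖ContinuousLinearMap.id 𝕜 X + T‖ = 1 + ‖T‖

/-- Narrow operators: for all `x, y` in the unit sphere of `X`, all `φ ∈ X*` and all `ε > 0` there
is `z` in the unit sphere of `X` with `‖T (y - z)‖ + |φ (y - z)| ≤ ε` and `‖x + z‖ ≥ 2 - ε`.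
The codomain is only asked to be seminormed, so that the definition applies to quotient maps. -/
def IsNarrow {𝕜 : Type*} [RCLike 𝕜] {X E : Type*} [NormedAddCommGroup X] [NormedSpace 𝕜 X]
    [SeminormedAddCommGroup E] [NormedSpace 𝕜 E] (T : X →L[𝕜] E) : Prop :=
  ∀ x y : X, ‖x‖ = 1 → ‖y‖ = 1 → ∀ φ : X →L[𝕜] 𝕜, ∀ ε : ℝ, 0 < ε →
    ∃ z : X, ‖z‖ = 1 ∧ ‖T (y - z)‖ + ‖φ (y - z)‖ ≤ ε ∧ 2 - ε ≤ ‖x + z‖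

/-- Rich subspaces: `X` has the Daugavet property, `Y` is a closed subspace of `X`, and the
quotient map `X → X / Y` (where `X / Y` carries the quotient norm) is narrow. -/
structure IsRich {𝕜 : Type*} [RCLike 𝕜] {X : Type*} [NormedAddCommGroup X] [NormedSpace 𝕜 X]
    (Y : Submodule 𝕜 X) : Prop where
  daugavet : HasDaugavetProperty 𝕜 X
  closed : IsClosed (Y : Set X)
  narrow : IsNarrow (Y.mkQL : X →L[𝕜] X ⧸ Y)

end BanachSpaces

noncomputable section HarmonicAnalysis

/-- The normalized Haar measure of a compact group, i.e. the regular Haar measure that gives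
the whole group mass one. -/
abbrev normalizedHaar (G : Type*) [CommGroup G] [TopologicalSpace G] [IsTopologicalGroup G]
    [CompactSpace G] [MeasurableSpace G] [BorelSpace G] : Measure G :=
  Measure.haarMeasure (⊤ : TopologicalSpace.PositiveCompacts G)

variable {G : Type*} [CommGroup G] [TopologicalSpace G] [IsTopologicalGroup G]
    [CompactSpace G] [MeasurableSpace G] [BorelSpace G]

/-- The Fourier coefficient `∫ conj γ · f dm` of `f` at the character `γ`. -/
def fourierTransform (f : G → ℂ) (γ : PontryaginDual G) : ℂ :=
  ∫ x, conj (γ x : ℂ) * f x ∂(normalizedHaar G)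

/-- The spectrum of `f`: the set of the characters at which the Fourier transform of `f` does not
vanish. -/
def fourierSpec (f : G → ℂ) : Set (PontryaginDual G) :=
  {γ | fourierTransform f γ ≠ 0}

lemma integrable_conj_char_mul {f : G → ℂ} (hf : Integrable f (normalizedHaar G))
    (γ : PontryaginDual G) :
    Integrable (fun x => conj (γ x : ℂ) * f x) (normalizedHaar G) := by
  have hc : Continuous fun x : G => conj (γ x : ℂ) :=
    Complex.continuous_conj.comp (continuous_subtype_val.comp (map_continuous γ))
  refine hf.bdd_mul (c := 1) hc.aestronglyMeasurable (Filter.Eventually.of_forall fun x => ?_)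
  exact ((RCLike.norm_conj _).trans (Circle.norm_coe (γ x))).le

lemma fourierTransform_add {f g : G → ℂ} (hf : Integrable f (normalizedHaar G))
    (hg : Integrable g (normalizedHaar G)) (γ : PontryaginDual G) :
    fourierTransform (f + g) γ = fourierTransform f γ + fourierTransform g γ := by
  unfold fourierTransform
  rw [← integral_add (integrable_conj_char_mul hf γ) (integrable_conj_char_mul hg γ)]
  simp [mul_add]

lemma fourierTransform_smul (c : ℂ) (f : G → ℂ) (γ : PontryaginDual G) :
    fourierTransform (c • f) γ = c * fourierTransform f γ := by
  unfold fourierTransform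
  rw [← integral_const_mul]
  simp [mul_left_comm]

lemma fourierTransform_congr {f g : G → ℂ} (h : f =ᵐ[normalizedHaar G] g)
    (γ : PontryaginDual G) : fourierTransform f γ = fourierTransform g γ :=
  integral_congr_ae (h.mono fun x hx => by simp only [hx])

lemma ContinuousMap.integrable_normalizedHaar (f : C(G, ℂ)) :
    Integrable f (normalizedHaar G) :=
  f.continuous.integrable_of_hasCompactSupport (HasCompactSupport.of_compactSpace f)

lemma fourierSpec_zero : fourierSpec (0 : G → ℂ) = ∅ := by
  simp [fourierSpec, fourierTransform]

lemma fourierSpec_add {f g : G → ℂ} (hf : Integrable f (normalizedHaar G))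
    (hg : Integrable g (normalizedHaar G)) :
    fourierSpec (f + g) ⊆ fourierSpec f ∪ fourierSpec g := by
  intro γ hγ
  by_contra h
  simp only [fourierSpec, Set.mem_union, Set.mem_ofPred_eq, not_or, not_not] at h hγ
  exact hγ (by rw [fourierTransform_add hf hg, h.1, h.2, add_zero])

lemma fourierSpec_smul (c : ℂ) (f : G → ℂ) : fourierSpec (c • f) ⊆ fourierSpec f := by
  intro γ hγ h
  exact hγ (by rw [fourierTransform_smul, h, mul_zero])

lemma fourierSpec_congr {f g : G → ℂ} (h : f =ᵐ[normalizedHaar G] g) :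
    fourierSpec f = fourierSpec g := by
  ext γ
  simp only [fourierSpec, Set.mem_ofPred_eq, fourierTransform_congr h γ]

/-- `C_Λ(G)`: the continuous functions (with the supremum norm) with spectrum in `Λ`. -/
def continuousWithSpec (Λ : Set (PontryaginDual G)) : Submodule ℂ C(G, ℂ) where
  carrier := {f | fourierSpec (f : G → ℂ) ⊆ Λ}
  zero_mem' := by
    simp [fourierSpec_zero]
  add_mem' := by
    intro f g hf hg
    refine Set.Subset.trans ?_ (Set.union_subset hf hg)
    exact fourierSpec_add f.integrable_normalizedHaar g.integrable_normalizedHaar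
  smul_mem' := by
    intro c f hf
    exact Set.Subset.trans (fourierSpec_smul c f) hf

/-- `L¹_Λ(G)`: the (classes of) integrable functions (with the `L¹`-norm) with spectrum in `Λ`. -/
def lOneWithSpec (Λ : Set (PontryaginDual G)) : Submodule ℂ (Lp ℂ 1 (normalizedHaar G)) where
  carrier := {f | fourierSpec (f : G → ℂ) ⊆ Λ}
  zero_mem' := by
    have h := fourierSpec_congr (Lp.coeFn_zero ℂ 1 (normalizedHaar G))
    exact (h.trans fourierSpec_zero).subset.trans (Set.empty_subset Λ)
  add_mem' := by
    intro f g hf hg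
    refine Set.Subset.trans ?_ (Set.union_subset hf hg)
    rw [fourierSpec_congr (Lp.coeFn_add f g)]
    exact fourierSpec_add (L1.integrable_coeFn f) (L1.integrable_coeFn g)
  smul_mem' := by
    intro c f hf
    refine Set.Subset.trans ?_ hf
    rw [fourierSpec_congr (Lp.coeFn_smul c f)]
    exact fourierSpec_smul c f

end HarmonicAnalysis

/-! Both parts are instances of `isRich_vanishingOutside`, a statement about bounded biorthogonal
systems. Approximate `x`, `y` by unit vectors `x'`, `y'` of finite spectrum. They lie in the space
of some `Θ` which is `Λ` plus a finite set `F`, and this space has the Daugavet property. On it `φ`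
and the coefficients at `F` form a finite-rank operator, and such operators are narrow
(`exists_norm_map_sub_le`). So some `z` there has `‖x' + z‖` near 2, while `φ` and the coefficients
at `F` are small on `y' - z`. Subtracting a small combination of the characters in `F` moves `y' -
z` into the space of `Λ`, so its class in the quotient is small.

Narrowness of finite-rank operators follows from Krein–Milman and small slices around extreme
points. Density of finite spectrum (`dense_finite_fourierSpec`) follows from Stone–Weierstrass
modulo the common kernel of the characters, so it is not needed that characters separate points. -/

/-! ### Convexity in finite dimension. -/

/-- In finite dimension, the convex hull of a compact set is compact. -/
lemma IsCompact.convexHull_of_finiteDimensional {E : Type*} [NormedAddCommGroup E]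
    [NormedSpace ℝ E] [FiniteDimensional ℝ E] {C : Set E} (hC : IsCompact C) :
    IsCompact (convexHull ℝ C) := by
  -- Carathéodory: at most `finrank + 1` points suffice, so the hull is a finite union of continuous
  -- images of compact sets.
  have key : convexHull ℝ C = ⋃ m ∈ Set.Iic (Module.finrank ℝ E + 1),
      (fun p : (Fin m → ℝ) × (Fin m → E) => ∑ i, p.1 i • p.2 i) ''
        (stdSimplex ℝ (Fin m) ×ˢ Set.univ.pi fun _ => C) := by
    apply Set.Subset.antisymm
    · intro x hx
      obtain ⟨ι, _, z, w, hz, hind, hw, hw1, hx⟩ := eq_pos_convex_span_of_mem_convexHull hx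
      have hcard : Fintype.card ι ≤ Module.finrank ℝ E + 1 :=
        hind.card_le_finrank_succ.trans (by gcongr; exact Submodule.finrank_le _)
      simp only [Set.mem_iUnion]
      let e := (Fintype.equivFin ι).symm
      refine ⟨Fintype.card ι, hcard, (fun i => w (e i), fun i => z (e i)),
        ⟨⟨fun i => (hw _).le, ?_⟩, fun i _ => hz ⟨_, rfl⟩⟩, ?_⟩
      · rw [← hw1]; exact e.sum_comp w
      · rw [← hx]; exact e.sum_comp fun i => w i • z i
    · simp only [Set.iUnion_subset_iff]
      rintro m - _ ⟨⟨w, z⟩, ⟨⟨hw, hw1⟩, hz⟩, rfl⟩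
      exact (convex_convexHull ℝ C).sum_mem (fun i _ => hw i) hw1
        fun i _ => subset_convexHull ℝ C (hz i trivial)
  rw [key]
  refine (Set.finite_Iic _).isCompact_biUnion fun m _ => ?_
  refine ((isCompact_stdSimplex ℝ (Fin m)).prod (isCompact_univ_pi fun _ => hC)).image ?_
  fun_prop

/-- Extreme points of a compact convex set in finite dimension are contained in small slices. -/
lemma exists_slice_subset_ball {E : Type*} [NormedAddCommGroup E]
    [NormedSpace ℝ E] [FiniteDimensional ℝ E] {K : Set E} (hK : IsCompact K) (hKc : Convex ℝ K)
    {e : E} (he : e ∈ K.extremePoints ℝ) {ε : ℝ} (hε : 0 < ε) :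
    ∃ (g : E →L[ℝ] ℝ) (a : ℝ), a < g e ∧ ∀ k ∈ K, a < g k → ‖k - e‖ < ε := by
  have hC : IsCompact (K \ Metric.ball e ε) := hK.diff Metric.isOpen_ball
  have he' : e ∉ convexHull ℝ (K \ Metric.ball e ε) := by
    intro h
    have hsub : convexHull ℝ (K \ Metric.ball e ε) ⊆ K := convexHull_min Set.sdiff_subset hKc
    -- Milman's argument: `e` would stay extreme in the smaller hull, hence belong to the set that
    -- generates it.
    have h1 := inter_extremePoints_subset_extremePoints_of_subset hsub ⟨h, he⟩
    exact (extremePoints_convexHull_subset h1).2 (Metric.mem_ball_self hε)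
  obtain ⟨g, a, h1, h2⟩ := geometric_hahn_banach_closed_point (convex_convexHull ℝ _)
    hC.convexHull_of_finiteDimensional.isClosed he'
  refine ⟨g, a, h2, fun k hk hak => ?_⟩
  by_contra hlt
  refine absurd (h1 k (subset_convexHull ℝ _ ⟨hk, ?_⟩)) hak.not_gt
  simpa [dist_eq_norm] using hlt

/-! ### Slices and finite-rank operators under the Daugavet property. -/

/-- Factor out the larger coefficient: the combination differs from that multiple of `x + z` by a
multiple of a single vector. -/
lemma norm_smul_add_smul_ge {X : Type*} [NormedAddCommGroup X] [NormedSpace ℂ X] {x z : X}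
    (hx : ‖x‖ ≤ 1) (hz : ‖z‖ ≤ 1) {δ : ℝ} (h : 2 - δ ≤ ‖x + z‖) {a b : ℝ} (ha : 0 ≤ a)
    (hb : 0 ≤ b) : a + b - (a + b) * δ ≤ ‖a • x + b • z‖ := by
  have hδ : 0 ≤ δ := by linarith [norm_add_le x z]
  rcases le_total a b with hab | hab
  · have h1 : b • (x + z) = (a • x + b • z) + (b - a) • x := by module
    have h2 := norm_add_le (a • x + b • z) ((b - a) • x)
    rw [← h1, norm_smul, norm_smul, Real.norm_of_nonneg hb, Real.norm_of_nonneg (by linarith)] at h2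
    nlinarith [mul_le_mul_of_nonneg_left h hb, mul_nonneg ha hδ,
      mul_le_mul_of_nonneg_left hx (sub_nonneg.2 hab)]
  · have h1 : a • (x + z) = (a • x + b • z) + (a - b) • z := by module
    have h2 := norm_add_le (a • x + b • z) ((a - b) • z)
    rw [← h1, norm_smul, norm_smul, Real.norm_of_nonneg ha, Real.norm_of_nonneg (by linarith)] at h2
    nlinarith [mul_le_mul_of_nonneg_left h ha, mul_nonneg hb hδ,
      mul_le_mul_of_nonneg_left hz (sub_nonneg.2 hab)]

namespace HasDaugavetProperty

variable {X : Type*} [NormedAddCommGroup X] [NormedSpace ℂ X]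

/-- Test the Daugavet equation on the operator `f ⊗ x`. A vector `u` nearly attaining the norm 2 has
`‖f u‖` close to 1, and a rotation makes `f u` positive. -/
lemma exists_mem_slice (hX : HasDaugavetProperty ℂ X) (f : X →L[ℂ] ℂ) (hf : ‖f‖ = 1) {x : X}
    (hx : ‖x‖ = 1) {δ : ℝ} (hδ : 0 < δ) :
    ∃ z : X, ‖z‖ ≤ 1 ∧ 1 - δ < (f z).re ∧ 2 - δ ≤ ‖x + z‖ := by
  wlog hδ1 : δ < 1 generalizing δ
  · obtain ⟨z, h1, h2, h3⟩ := this (δ := 1 / 2) (by norm_num) (by norm_num)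
    exact ⟨z, h1, by linarith, by linarith⟩
  have hx0 : x ≠ 0 := by rintro rfl; simp at hx
  have hf0 : f ≠ 0 := by rintro rfl; simp at hf
  let T : X →L[ℂ] X := f.smulRight x
  have hT1 : ‖T‖ = 1 := by simp [T, hf, hx]
  have hrank : LinearMap.rank (T : X →ₗ[ℂ] X) = 1 := by
    have : LinearMap.range (T : X →ₗ[ℂ] X) = Submodule.span ℂ {x} := by
      obtain ⟨v, hv⟩ : ∃ v, f v ≠ 0 := by
        by_contra! h
        exact hf0 (ContinuousLinearMap.ext h)
      apply le_antisymm
      · rintro _ ⟨w, rfl⟩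
        exact Submodule.mem_span_singleton.2 ⟨f w, rfl⟩
      · rw [Submodule.span_singleton_le_iff_mem]
        refine ⟨(f v)⁻¹ • v, ?_⟩
        simp [T, hv]
    rw [LinearMap.rank, this, rank_submodule_eq_one_iff]
    exact ⟨x, Submodule.mem_span_singleton_self x, hx0, le_rfl⟩
  have hT := hX T hrank
  rw [hT1] at hT
  obtain ⟨u, hu, hu2⟩ := (ContinuousLinearMap.id ℂ X + T).exists_lt_apply_of_lt_opNorm
    (r := 2 - δ / 2) (by linarith)
  have hu2' : 2 - δ / 2 < ‖u + f u • x‖ := by simpa [T] using hu2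
  have hfu : ‖f u‖ ≤ ‖u‖ := by simpa [hf] using f.le_opNorm u
  have hfu1 : 1 - δ / 2 < ‖f u‖ := by
    have := norm_add_le u (f u • x)
    rw [norm_smul, hx] at this
    linarith
  have hfu0 : f u ≠ 0 := by
    intro h; rw [h] at hfu1; simp at hfu1; linarith
  let c : ℂ := conj (f u) / ‖f u‖
  have hn0 : (‖f u‖ : ℂ) ≠ 0 := by simpa using hfu0
  have hc : ‖c‖ = 1 := by
    simp [c, hfu0]
  have hcf : c * f u = (‖f u‖ : ℂ) := by
    simp only [c]
    rw [div_mul_eq_mul_div, Complex.conj_mul', sq, mul_div_assoc, div_self hn0, mul_one]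
  refine ⟨c • u, by rw [norm_smul, hc, one_mul]; exact hu.le, ?_, ?_⟩
  · rw [map_smul, smul_eq_mul, hcf, Complex.ofReal_re]
    linarith
  · have h1 : c • (u + f u • x) = (x + c • u) - ((1 : ℂ) - ‖f u‖) • x := by
      rw [smul_add, smul_smul, hcf]; module
    have h2 : ‖c • (u + f u • x)‖ = ‖u + f u • x‖ := by rw [norm_smul, hc, one_mul]
    have h3 := norm_sub_le (x + c • u) (((1 : ℂ) - ‖f u‖) • x)
    have h4 : ‖((1 : ℂ) - ‖f u‖)‖ = 1 - ‖f u‖ := by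
      rw [← Complex.ofReal_one, ← Complex.ofReal_sub, Complex.norm_real,
        Real.norm_of_nonneg (by linarith)]
    rw [← h1, h2, norm_smul, h4, hx] at h3
    linarith

/-- A real functional is the real part of a complex one of norm `‖f‖`, and normalizing reduces to
`exists_mem_slice`. -/
lemma exists_mem_real_slice (hX : HasDaugavetProperty ℂ X) (g : X →L[ℝ] ℝ) {a : ℝ} {b : X}
    (hb : ‖b‖ ≤ 1) (hab : a < g b) {x : X} (hx : ‖x‖ = 1) {δ : ℝ} (hδ : 0 < δ) :
    ∃ z : X, ‖z‖ ≤ 1 ∧ a < g z ∧ 2 - δ ≤ ‖x + z‖ := by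
  let f : X →L[ℂ] ℂ := StrongDual.extendRCLike g
  have hfg : ∀ w, (f w).re = g w := fun w => by
    simp [f, StrongDual.extendRCLike_apply]
  by_cases hf : f = 0
  · refine ⟨x, hx.le, ?_, ?_⟩
    · rw [← hfg] at hab ⊢
      simpa [hf] using hab
    · rw [← two_smul ℝ x, norm_smul, hx]; norm_num; exact hδ.le
  have hf' : 0 < ‖f‖ := norm_pos_iff.2 hf
  have haf : a < ‖f‖ := by
    rw [← hfg] at hab
    exact hab.trans_le ((Complex.re_le_norm _).trans ((f.le_opNorm b).trans
      (mul_le_of_le_one_right hf'.le hb)))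
  -- The second entry gives `1 - η ≥ a / ‖f‖`.
  let η := min δ ((‖f‖ - a) / ‖f‖)
  have hη : 0 < η := lt_min hδ (div_pos (sub_pos.2 haf) hf')
  obtain ⟨z, h1, h2, h3⟩ := hX.exists_mem_slice ((‖f‖ : ℂ)⁻¹ • f)
    (by rw [norm_smul]; simp [hf]) hx hη
  refine ⟨z, h1, ?_, by linarith [min_le_left δ ((‖f‖ - a) / ‖f‖)]⟩
  have h4 : ((‖f‖ : ℂ)⁻¹ • f) z = ((‖f‖⁻¹ : ℝ) : ℂ) * f z := by simp
  rw [h4, Complex.re_ofReal_mul, hfg] at h2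
  have h5 : η ≤ (‖f‖ - a) / ‖f‖ := min_le_right _ _
  have h6 : 1 - (‖f‖ - a) / ‖f‖ < ‖f‖⁻¹ * g z := by linarith
  have h7 : 1 - (‖f‖ - a) / ‖f‖ = ‖f‖⁻¹ * a := by field_simp; ring
  rw [h7] at h6
  exact lt_of_mul_lt_mul_left h6 (inv_nonneg.2 hf'.le)

lemma exists_mem_real_slice_add_smul [Nontrivial X] (hX : HasDaugavetProperty ℂ X)
    (g : X →L[ℝ] ℝ) {a : ℝ} {b : X}
    (hb : ‖b‖ ≤ 1) (hab : a < g b) (u : X) {l : ℝ} (hl : 0 ≤ l) {δ : ℝ} (hδ : 0 < δ) :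
    ∃ z : X, ‖z‖ ≤ 1 ∧ a < g z ∧ ‖u‖ + l - δ ≤ ‖u + l • z‖ := by
  obtain ⟨x, hx, hu⟩ : ∃ x : X, ‖x‖ = 1 ∧ u = ‖u‖ • x := by
    by_cases hu : u = 0
    · obtain ⟨v, hv⟩ := exists_ne (0 : X)
      exact ⟨(‖v‖⁻¹ : ℝ) • v, by rw [norm_smul]; simp [hv], by simp [hu]⟩
    · exact ⟨(‖u‖⁻¹ : ℝ) • u, by rw [norm_smul]; simp [hu], by simp [smul_smul, hu]⟩
  have hs : 0 < ‖u‖ + l + 1 := by positivity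
  obtain ⟨z, h1, h2, h3⟩ := hX.exists_mem_real_slice g hb hab hx (div_pos hδ hs)
  refine ⟨z, h1, h2, ?_⟩
  have h4 := norm_smul_add_smul_ge hx.le h1 h3 (norm_nonneg u) hl
  rw [← hu] at h4
  refine le_trans ?_ h4
  have : (‖u‖ + l) * (δ / (‖u‖ + l + 1)) ≤ δ := by
    rw [mul_div_assoc', div_le_iff₀ hs]; nlinarith [norm_nonneg u]
  linarith

/-- Each new point is chosen relative to the partial sum already built, so norms add up to an
arbitrarily small loss. -/
lemma exists_mem_real_slices [Nontrivial X] (hX : HasDaugavetProperty ℂ X) {ι : Type*}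
    (s : Finset ι) (g : ι → X →L[ℝ] ℝ) (a : ι → ℝ)
    (hg : ∀ i, ∃ b : X, ‖b‖ ≤ 1 ∧ a i < g i b) (w : ι → ℝ) (hw : ∀ i, 0 ≤ w i) (x : X)
    {δ : ℝ} (hδ : 0 < δ) :
    ∃ z : ι → X, (∀ i, ‖z i‖ ≤ 1 ∧ a i < g i (z i)) ∧
      ‖x‖ + ∑ i ∈ s, w i - δ ≤ ‖x + ∑ i ∈ s, w i • z i‖ := by
  classical
  induction s using Finset.induction_on generalizing δ with
  | empty =>
    choose b hb using hg
    exact ⟨b, hb, by simpa using hδ.le⟩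
  | insert i s hi ih =>
    obtain ⟨z, hz, h⟩ := ih (half_pos hδ)
    obtain ⟨b, hb, hab⟩ := hg i
    obtain ⟨v, hv1, hv2, hv3⟩ := hX.exists_mem_real_slice_add_smul (g i) hb hab
      (x + ∑ j ∈ s, w j • z j) (hw i) (half_pos hδ)
    refine ⟨Function.update z i v, fun j => ?_, ?_⟩
    · by_cases hj : j = i
      · subst hj; simpa using ⟨hv1, hv2⟩
      · simpa [hj] using hz j
    · rw [Finset.sum_insert hi, Finset.sum_insert hi, Function.update_self]
      have : ∑ j ∈ s, w j • Function.update z i v j = ∑ j ∈ s, w j • z j :=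
        Finset.sum_congr rfl fun j hj => by
          rw [Function.update_of_ne (ne_of_mem_of_not_mem hj hi)]
      rw [this, add_comm (w i • v), ← add_assoc x]
      linarith

/-- Operators with finite-dimensional range on a space with the Daugavet property are narrow. -/
theorem exists_norm_map_sub_le {E : Type*} [NormedAddCommGroup E] [NormedSpace ℝ E]
    [FiniteDimensional ℝ E] (hX : HasDaugavetProperty ℂ X) (T : X →L[ℝ] E) {x y : X}
    (hx : ‖x‖ = 1) (hy : ‖y‖ ≤ 1) {ε : ℝ} (hε : 0 < ε) :
    ∃ z : X, ‖z‖ ≤ 1 ∧ ‖T (y - z)‖ ≤ ε ∧ 2 - ε ≤ ‖x + z‖ := by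
  have : Nontrivial X := ⟨x, 0, by rintro rfl; simp at hx⟩
  let K : Set E := closure (T '' Metric.closedBall 0 1)
  have hKc : Convex ℝ K := ((convex_closedBall (0 : X) 1).linear_image (T : X →ₗ[ℝ] E)).closure
  have hK : IsCompact K := by
    refine Bornology.IsBounded.isCompact_closure ?_
    exact T.lipschitz.isBounded_image Metric.isBounded_closedBall
  -- Krein–Milman: `T y` is nearly a convex combination of extreme points `e i`. Their small slices
  -- pull back along `T` to slices of the unit ball of `X`, from which the `z i` are taken.
  have hTy : T y ∈ closure (convexHull ℝ (K.extremePoints ℝ)) := by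
    rw [closure_convexHull_extremePoints hK hKc]
    exact subset_closure ⟨y, by simpa using hy, rfl⟩
  obtain ⟨v, hv, hyv⟩ := Metric.mem_closure_iff.1 hTy (ε / 2) (half_pos hε)
  obtain ⟨ι, _, w, e, hw, hw1, he, rfl⟩ := mem_convexHull_iff_exists_fintype.1 hv
  choose g a hga hg using fun i => exists_slice_subset_ball hK hKc (he i) (half_pos hε)
  obtain ⟨z, hz, h⟩ := hX.exists_mem_real_slices Finset.univ (fun i => (g i).comp T) a
    (fun i => by
      -- The slice is open and contains `e i`, so it meets the image of the ball itself and not only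
      -- its closure.
      have hmem : e i ∈ closure (T '' Metric.closedBall 0 1) := (he i).1
      obtain ⟨_, h1, b, hb, rfl⟩ := mem_closure_iff.1 hmem {k | a i < g i k}
        (isOpen_lt continuous_const (g i).continuous) (hga i)
      exact ⟨b, by simpa using hb, h1⟩) w hw x hε
  refine ⟨∑ i, w i • z i, ?_, ?_, ?_⟩
  · calc ‖∑ i, w i • z i‖ ≤ ∑ i, w i := norm_sum_le_of_le _ fun i _ => by
          rw [norm_smul, Real.norm_of_nonneg (hw i)]
          exact mul_le_of_le_one_right (hw i) (hz i).1
      _ = 1 := hw1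
  · have h1 : ‖∑ i, w i • e i - T (∑ i, w i • z i)‖ ≤ ε / 2 := by
      rw [map_sum, ← Finset.sum_sub_distrib]
      calc ‖∑ i, (w i • e i - T (w i • z i))‖ ≤ ∑ i, w i * (ε / 2) :=
            norm_sum_le_of_le _ fun i _ => by
              rw [map_smul, ← smul_sub, norm_smul, Real.norm_of_nonneg (hw i), norm_sub_rev]
              refine mul_le_mul_of_nonneg_left (hg i _ ?_ (hz i).2).le (hw i)
              exact subset_closure ⟨z i, by simpa using (hz i).1, rfl⟩
        _ = ε / 2 := by rw [← Finset.sum_mul, hw1, one_mul]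
    rw [dist_eq_norm] at hyv
    rw [map_sub, ← sub_add_sub_cancel _ (∑ i, w i • e i)]
    exact (norm_add_le _ _).trans (by linarith)
  · rw [hx, hw1] at h
    linarith

end HasDaugavetProperty

/-- Conjugation by `e` preserves norm and rank. This passes from the submodule `⊤`, the case `Θ =
univ`, to the whole space. -/
lemma HasDaugavetProperty.of_linearIsometryEquiv {𝕜 : Type*} [RCLike 𝕜] {X Y : Type*}
    [NormedAddCommGroup X] [NormedSpace 𝕜 X] [NormedAddCommGroup Y] [NormedSpace 𝕜 Y]
    (e : X ≃ₗᵢ[𝕜] Y) (hX : HasDaugavetProperty 𝕜 X) : HasDaugavetProperty 𝕜 Y := by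
  intro T hT
  have hnorm : ∀ S : Y →L[𝕜] Y, ‖((e.symm : Y →L[𝕜] X).comp S).comp (e : X →L[𝕜] Y)‖ = ‖S‖ := by
    intro S
    apply le_antisymm
    · refine ContinuousLinearMap.opNorm_le_bound _ (norm_nonneg _) fun x => ?_
      simpa using S.le_opNorm (e x)
    · refine ContinuousLinearMap.opNorm_le_bound _ (norm_nonneg _) fun y => ?_
      simpa using (((e.symm : Y →L[𝕜] X).comp S).comp (e : X →L[𝕜] Y)).le_opNorm (e.symm y)
  have h := hX (((e.symm : Y →L[𝕜] X).comp T).comp (e : X →L[𝕜] Y)) (by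
    rw [LinearMap.rank, rank_submodule_eq_one_iff] at hT ⊢
    obtain ⟨_, ⟨w, rfl⟩, hw0, hw⟩ := hT
    refine ⟨e.symm (T w), ⟨e.symm w, by simp⟩, by simpa using hw0, ?_⟩
    rintro _ ⟨x, rfl⟩
    obtain ⟨a, ha⟩ := Submodule.mem_span_singleton.1 (hw ⟨e x, rfl⟩)
    exact Submodule.mem_span_singleton.2 ⟨a, by simpa using congrArg e.symm ha⟩)
  rw [← hnorm, ← hnorm T, ← h]
  congr 1
  ext x
  simp

/-! ### Richness for biorthogonal systems. -/

lemma norm_sub_inv_norm_smul {X : Type*} [NormedAddCommGroup X] [NormedSpace ℂ X] {z : X}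
    (hz : z ≠ 0) : ‖z - (‖z‖⁻¹ : ℂ) • z‖ = |‖z‖ - 1| := by
  have hz' : ‖z‖ ≠ 0 := norm_ne_zero_iff.2 hz
  have h1 : z - (‖z‖⁻¹ : ℂ) • z = ((1 - ‖z‖⁻¹ : ℝ) : ℂ) • z := by
    push_cast; rw [sub_smul, one_smul]
  have h2 : ‖z‖ - 1 = (1 - ‖z‖⁻¹) * ‖z‖ := by field_simp
  rw [h1, norm_smul, Complex.norm_real, h2, abs_mul, abs_norm, Real.norm_eq_abs]

lemma norm_inv_norm_smul {X : Type*} [NormedAddCommGroup X] [NormedSpace ℂ X] {z : X}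
    (hz : z ≠ 0) : ‖(‖z‖⁻¹ : ℂ) • z‖ = 1 := by
  rw [norm_smul]; simp [hz]

section Biorthogonal

variable {X Γ : Type*} [NormedAddCommGroup X] [NormedSpace ℂ X]

/-- The vectors at which all coordinate functionals with index outside of `Λ` vanish. -/
def vanishingOutside (c : Γ → X →L[ℂ] ℂ) (Λ : Set Γ) : Submodule ℂ X where
  carrier := {x | ∀ γ ∉ Λ, c γ x = 0}
  zero_mem' := fun γ _ => map_zero _
  add_mem' := fun hx hy γ hγ => by rw [map_add, hx γ hγ, hy γ hγ, add_zero]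
  smul_mem' := fun a x hx γ hγ => by rw [map_smul, hx γ hγ, smul_zero]

lemma mem_vanishingOutside {c : Γ → X →L[ℂ] ℂ} {Λ : Set Γ} {x : X} :
    x ∈ vanishingOutside c Λ ↔ ∀ γ ∉ Λ, c γ x = 0 := Iff.rfl

lemma exists_unit_finite_support (c : Γ → X →L[ℂ] ℂ)
    (hd : Dense {x : X | {γ | c γ x ≠ 0}.Finite}) {x : X} (hx : ‖x‖ = 1) {δ : ℝ} (hδ : 0 < δ) :
    ∃ x' : X, ‖x'‖ = 1 ∧ ‖x - x'‖ ≤ δ ∧ {γ | c γ x' ≠ 0}.Finite := by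
  obtain ⟨v, hv, hxv⟩ := Metric.dense_iff.1 hd x (min (δ / 2) 1) (by positivity)
  rw [Metric.mem_ball, dist_comm, dist_eq_norm] at hv
  have hv1 : ‖x - v‖ < δ / 2 := hv.trans_le (min_le_left _ _)
  have hv2 : ‖x - v‖ < 1 := hv.trans_le (min_le_right _ _)
  have hv0 : v ≠ 0 := by rintro rfl; rw [sub_zero, hx] at hv2; exact lt_irrefl _ hv2
  refine ⟨(‖v‖⁻¹ : ℂ) • v, norm_inv_norm_smul hv0, ?_, ?_⟩
  · have h1 := abs_norm_sub_norm_le v x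
    rw [hx, norm_sub_rev v x, ← norm_sub_inv_norm_smul hv0] at h1
    rw [← sub_add_sub_cancel x v]
    exact (norm_add_le _ _).trans (by linarith)
  · refine Set.Finite.subset hxv fun γ hγ h => hγ ?_
    rw [map_smul, h, smul_zero]

/-- Let `(c, e)` be a bounded biorthogonal system whose finitely supported vectors are dense. If all
coordinate subspaces with support containing `Λ` have the Daugavet property, then the one with
support `Λ` is rich. -/
theorem isRich_vanishingOutside (c : Γ → X →L[ℂ] ℂ) (e : Γ → X) (he : ∀ γ, ‖e γ‖ ≤ 1)
    (hc1 : ∀ γ, c γ (e γ) = 1) (hc0 : ∀ γ γ', γ ≠ γ' → c γ (e γ') = 0)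
    (hd : Dense {x : X | {γ | c γ x ≠ 0}.Finite}) (Λ : Set Γ)
    (h : ∀ Θ, Λ ⊆ Θ → HasDaugavetProperty ℂ (vanishingOutside c Θ)) :
    IsRich (vanishingOutside c Λ) where
  daugavet := by
    have htop : vanishingOutside c Set.univ = ⊤ :=
      eq_top_iff.2 fun x _ γ hγ => absurd trivial hγ
    have h1 := h Set.univ (Set.subset_univ _)
    rw [htop] at h1
    exact h1.of_linearIsometryEquiv (LinearIsometryEquiv.ofTop X ⊤ rfl)
  closed := by
    have : (vanishingOutside c Λ : Set X) = ⋂ γ ∈ Λᶜ, {x | c γ x = 0} := by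
      ext x; simp [mem_vanishingOutside]
    rw [this]
    exact isClosed_biInter fun γ _ => isClosed_eq (c γ).continuous continuous_const
  narrow := by
    classical
    intro x y hx hy φ ε hε
    -- The errors will be `3δ` in the quotient, `(1 + 2‖φ‖)δ` under `φ`, and `3δ` in `‖x + z'‖`.
    obtain ⟨δ, hδ, hδ1, hδε⟩ : ∃ δ : ℝ, 0 < δ ∧ δ < 1 ∧ (4 + 3 * ‖φ‖) * δ ≤ ε := by
      have h4 : 0 < 4 + 3 * ‖φ‖ := by positivity
      refine ⟨min (1 / 2) (ε / (4 + 3 * ‖φ‖)), by positivity,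
        (min_le_left _ _).trans_lt (by norm_num), ?_⟩
      calc (4 + 3 * ‖φ‖) * min (1 / 2) (ε / (4 + 3 * ‖φ‖))
          ≤ (4 + 3 * ‖φ‖) * (ε / (4 + 3 * ‖φ‖)) := by gcongr; exact min_le_right _ _
        _ = ε := by field_simp
    obtain ⟨x', hx', hxx', hxf⟩ := exists_unit_finite_support c hd hx hδ
    obtain ⟨y', hy', hyy', hyf⟩ := exists_unit_finite_support c hd hy hδ
    let S : Finset Γ := hxf.toFinset ∪ hyf.toFinset
    let Θ : Set Γ := Λ ∪ S
    let F : Finset Γ := S.filter (· ∉ Λ)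
    have hx'Θ : x' ∈ vanishingOutside c Θ := fun γ hγ => by
      by_contra h0
      exact hγ (Or.inr (by simp [S, h0]))
    have hy'Θ : y' ∈ vanishingOutside c Θ := fun γ hγ => by
      by_contra h0
      exact hγ (Or.inr (by simp [S, h0]))
    let T : X →L[ℂ] (F → ℂ) × ℂ := (ContinuousLinearMap.pi fun γ : F => c γ).prod φ
    let T' : vanishingOutside c Θ →L[ℝ] (F → ℂ) × ℂ :=
      (T.comp (vanishingOutside c Θ).subtypeL).restrictScalars ℝ
    have hF : (0 : ℝ) < F.card + 1 := by positivity
    -- With this accuracy the `F.card` correction terms sum to at most `δ`; the `+ 1` covers empty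
    -- `F`.
    have hη : 0 < δ / (F.card + 1) := by positivity
    have hηδ : δ / (F.card + 1) ≤ δ := div_le_self hδ.le (by simp)
    obtain ⟨⟨z, hzΘ⟩, hz1, hTz, hxz⟩ := (h Θ Set.subset_union_left).exists_norm_map_sub_le T'
      (x := ⟨x', hx'Θ⟩) (y := ⟨y', hy'Θ⟩) hx' hy'.le hη
    replace hz1 : ‖z‖ ≤ 1 := hz1
    replace hxz : 2 - δ / (F.card + 1) ≤ ‖x' + z‖ := hxz
    replace hTz : ‖T (y' - z)‖ ≤ δ / (F.card + 1) := hTz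
    have hφz : ‖φ (y' - z)‖ ≤ δ := (norm_snd_le (T (y' - z))).trans (hTz.trans hηδ)
    have hcz : ∀ γ ∈ F, ‖c γ (y' - z)‖ ≤ δ / (F.card + 1) := fun γ hγ =>
      (norm_le_pi_norm (T (y' - z)).1 ⟨γ, hγ⟩).trans ((norm_fst_le _).trans hTz)
    -- Biorthogonality makes `p` cancel exactly the coefficients of `y' - z` outside `Λ`.
    let p : X := ∑ γ ∈ F, c γ (y' - z) • e γ
    have hp : ‖p‖ ≤ δ := by
      calc ‖p‖ ≤ ∑ γ ∈ F, δ / (F.card + 1) := norm_sum_le_of_le _ fun γ hγ => by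
            rw [norm_smul]
            exact (mul_le_of_le_one_right (norm_nonneg _) (he γ)).trans (hcz γ hγ)
        _ ≤ δ := by
            rw [Finset.sum_const, nsmul_eq_mul, mul_div_assoc', div_le_iff₀ hF]
            nlinarith
    have hmem : y' - z - p ∈ vanishingOutside c Λ := by
      intro γ hγ
      have hcp : c γ p = if γ ∈ F then c γ (y' - z) else 0 := by
        rw [map_sum, ← Finset.sum_ite_eq F γ fun γ' => c γ' (y' - z)]
        refine Finset.sum_congr rfl fun γ' _ => ?_
        split_ifs with heq
        · rw [heq, map_smul, hc1, smul_eq_mul, mul_one]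
        · rw [map_smul, hc0 _ _ heq, smul_zero]
      by_cases hγF : γ ∈ F
      · rw [map_sub, hcp, if_pos hγF, sub_self]
      · have hγΘ : γ ∉ Θ := by
          rintro (h1 | h1)
          · exact hγ h1
          · exact hγF (Finset.mem_filter.2 ⟨h1, hγ⟩)
        rw [map_sub, hcp, if_neg hγF, map_sub, hy'Θ γ hγΘ, hzΘ γ hγΘ, sub_zero, sub_zero]
    have hQ : ‖(vanishingOutside c Λ).mkQL (y' - z)‖ ≤ δ := by
      have h1 : (vanishingOutside c Λ).mkQL (y' - z) = (vanishingOutside c Λ).mkQL p :=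
        (Submodule.Quotient.eq _).2 hmem
      rw [h1]
      exact (Submodule.Quotient.norm_mk_le _ _).trans hp
    have hz2 : 1 - δ ≤ ‖z‖ := by
      have := norm_add_le x' z
      linarith
    have hz0 : z ≠ 0 := by rintro rfl; rw [norm_zero] at hz2; linarith
    let z' : X := (‖z‖⁻¹ : ℂ) • z
    have hzz' : ‖z - z'‖ ≤ δ := by
      rw [norm_sub_inv_norm_smul hz0, abs_le]
      constructor <;> linarith
    have hdec : y - z' = (y - y') + (y' - z) + (z - z') := by abel
    have hmkQ : ∀ v : X, ‖(vanishingOutside c Λ).mkQL v‖ ≤ ‖v‖ := fun v =>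
      Submodule.Quotient.norm_mk_le _ _
    refine ⟨z', norm_inv_norm_smul hz0, ?_, ?_⟩
    · have h1 : ‖(vanishingOutside c Λ).mkQL (y - z')‖ ≤ δ + δ + δ := by
        rw [hdec, map_add, map_add]
        exact norm_add₃_le.trans (add_le_add_three ((hmkQ _).trans hyy') hQ ((hmkQ _).trans hzz'))
      have h2 : ‖φ (y - z')‖ ≤ ‖φ‖ * δ + δ + ‖φ‖ * δ := by
        rw [hdec, map_add, map_add]
        exact norm_add₃_le.trans (add_le_add_three (φ.le_opNorm_of_le hyy') hφz
          (φ.le_opNorm_of_le hzz'))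
      nlinarith [mul_nonneg (norm_nonneg φ) hδ.le]
    · have h1 : x' + z = (x + z') - (x - x') + (z - z') := by abel
      have h2 : ‖x' + z‖ ≤ ‖x + z'‖ + δ + δ := by
        rw [h1]
        exact (norm_add_le _ _).trans (add_le_add ((norm_sub_le _ _).trans (by gcongr)) hzz')
      nlinarith [mul_nonneg (norm_nonneg φ) hδ.le]

end Biorthogonal

/-! ### Characters and Stone–Weierstrass. -/

noncomputable section Characters

variable {G : Type*} [CommGroup G] [TopologicalSpace G]

/-- A character as a continuous complex-valued function. -/
def characterMap (γ : PontryaginDual G) : C(G, ℂ) :=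
  ⟨fun x => (γ x : ℂ), continuous_subtype_val.comp (map_continuous γ)⟩

lemma characterMap_apply (γ : PontryaginDual G) (x : G) : characterMap γ x = (γ x : ℂ) := rfl

lemma norm_characterMap_le [CompactSpace G] (γ : PontryaginDual G) : ‖characterMap γ‖ ≤ 1 :=
  (ContinuousMap.norm_le _ zero_le_one).2 fun x => (Circle.norm_coe (γ x)).le

lemma characterMap_mul (γ γ' : PontryaginDual G) :
    characterMap γ * characterMap γ' = characterMap (γ * γ') := by
  ext x
  exact (Circle.coe_mul (γ x) (γ' x)).symm

lemma star_characterMap (γ : PontryaginDual G) :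
    star (characterMap γ) = characterMap γ⁻¹ := by
  ext x
  exact (Circle.coe_inv_eq_conj (γ x)).symm

lemma characterMap_one : characterMap (1 : PontryaginDual G) = 1 := by
  ext x
  exact Circle.coe_one

variable (G) in
/-- The trigonometric polynomials on `G`. -/
def trigPolynomial : StarSubalgebra ℂ C(G, ℂ) where
  carrier := Submodule.span ℂ (Set.range (characterMap (G := G)))
  zero_mem' := Submodule.zero_mem _
  add_mem' := Submodule.add_mem _
  one_mem' := Submodule.subset_span ⟨1, characterMap_one⟩
  mul_mem' := by
    intro f g hf hg
    have h := Submodule.mul_mem_mul hf hg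
    rw [Submodule.span_mul_span] at h
    refine Submodule.span_mono ?_ h
    rintro _ ⟨_, ⟨γ, rfl⟩, _, ⟨γ', rfl⟩, rfl⟩
    exact ⟨γ * γ', (characterMap_mul γ γ').symm⟩
  algebraMap_mem' := by
    intro c
    rw [Algebra.algebraMap_eq_smul_one]
    exact Submodule.smul_mem _ c (Submodule.subset_span ⟨1, characterMap_one⟩)
  star_mem' := by
    intro f hf
    change star f ∈ Submodule.span ℂ _
    induction hf using Submodule.span_induction with
    | mem f hf =>
      obtain ⟨γ, rfl⟩ := hf
      exact Submodule.subset_span ⟨γ⁻¹, (star_characterMap γ).symm⟩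
    | zero => rw [star_zero]; exact Submodule.zero_mem _
    | add f g _ _ hf hg => rw [star_add]; exact Submodule.add_mem _ hf hg
    | smul c f _ hf => rw [star_smul]; exact Submodule.smul_mem _ _ hf

lemma mem_trigPolynomial {f : C(G, ℂ)} :
    f ∈ trigPolynomial G ↔ f ∈ Submodule.span ℂ (Set.range (characterMap (G := G))) := Iff.rfl

variable (G) in
/-- The common kernel of all characters. -/
def characterKernel : Subgroup G := ⨅ γ : PontryaginDual G, (γ : G →* Circle).ker

lemma mem_characterKernel {x : G} :
    x ∈ characterKernel G ↔ ∀ γ : PontryaginDual G, γ x = 1 := by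
  simp [characterKernel, Subgroup.mem_iInf, MonoidHom.mem_ker]

lemma isClosed_characterKernel : IsClosed (characterKernel G : Set G) := by
  have : (characterKernel G : Set G) = ⋂ γ : PontryaginDual G, {x | γ x = 1} := by
    ext x; simp [mem_characterKernel]
  rw [this]
  exact isClosed_iInter fun γ => isClosed_eq (map_continuous γ) continuous_const

instance : IsClosed (characterKernel G : Set G) := isClosed_characterKernel

/-- Continuous functions that are invariant under the common kernel of all characters are uniform
limits of trigonometric polynomials. -/
lemma mem_closure_trigPolynomial [IsTopologicalGroup G] [CompactSpace G] {g : C(G, ℂ)}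
    (hg : ∀ x, ∀ h ∈ characterKernel G, g (x * h) = g x) :
    g ∈ closure (trigPolynomial G : Set C(G, ℂ)) := by
  let H := characterKernel G
  let π : C(G, G ⧸ H) := ⟨QuotientGroup.mk, continuous_quotient_mk'⟩
  have lift : ∀ f : C(G, ℂ), (∀ x, ∀ h ∈ H, f (x * h) = f x) → ∃ u : C(G ⧸ H, ℂ), u.comp π = f := by
    intro f hf
    have hf' : ∀ a b : G, QuotientGroup.leftRel H a b → f a = f b := fun a b hab => by
      have h1 := hf a _ (QuotientGroup.leftRel_apply.1 hab)
      rw [← h1, mul_inv_cancel_left]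
    exact ⟨⟨Quotient.lift f hf', f.continuous.quotient_lift hf'⟩, rfl⟩
  -- Characters are trivial on `H`, so they descend to `G ⧸ H`, where they separate points by the
  -- choice of `H`.
  let A : StarSubalgebra ℂ C(G ⧸ H, ℂ) :=
    (trigPolynomial G).comap (ContinuousMap.compStarAlgHom' ℂ ℂ π)
  have hA : A.SeparatesPoints := by
    intro a b
    induction a using QuotientGroup.induction_on with | H a =>
    induction b using QuotientGroup.induction_on with | H b =>
    intro hab
    have h1 : ¬ ∀ γ : PontryaginDual G, γ (a⁻¹ * b) = 1 := fun h =>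
      hab (QuotientGroup.eq.2 (mem_characterKernel.2 h))
    push Not at h1
    obtain ⟨γ, hγ⟩ := h1
    obtain ⟨u, hu⟩ := lift (characterMap γ) fun x h hh => by
      rw [characterMap_apply, map_mul, mem_characterKernel.1 hh γ, mul_one, characterMap_apply]
    refine ⟨u, ⟨u, ?_, rfl⟩, fun hab' => hγ ?_⟩
    · change u.comp π ∈ trigPolynomial G
      rw [hu]
      exact Submodule.subset_span ⟨γ, rfl⟩
    · have h2 : characterMap γ a = characterMap γ b := by rw [← hu]; exact hab'
      have h3 : γ a = γ b := Circle.ext h2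
      rw [map_mul, map_inv, h3, inv_mul_cancel]
  obtain ⟨u, rfl⟩ := lift g hg
  have hu : u ∈ closure (A : Set C(G ⧸ H, ℂ)) := by
    have := ContinuousMap.starSubalgebra_topologicalClosure_eq_top_of_separatesPoints A hA
    rw [← StarSubalgebra.topologicalClosure_coe, this]
    trivial
  have hmaps : Set.MapsTo (fun v : C(G ⧸ H, ℂ) => v.comp π) A (trigPolynomial G : Set C(G, ℂ)) :=
    fun v hv => hv
  exact hmaps.closure (ContinuousMap.continuous_precomp π) hu

end Characters

/-! ### Fourier coefficients and density of finite spectrum. -/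

noncomputable section FourierCoefficients

variable {G : Type*} [CommGroup G] [TopologicalSpace G] [IsTopologicalGroup G]
    [CompactSpace G] [MeasurableSpace G] [BorelSpace G]

instance : IsProbabilityMeasure (normalizedHaar G) :=
  ⟨by simpa using Measure.haarMeasure_self (K₀ := (⊤ : TopologicalSpace.PositiveCompacts G))⟩

lemma norm_fourierTransform_le (f : G → ℂ) (γ : PontryaginDual G) :
    ‖fourierTransform f γ‖ ≤ ∫ x, ‖f x‖ ∂(normalizedHaar G) := by
  refine (norm_integral_le_integral_norm _).trans_eq (integral_congr_ae (.of_forall fun x => ?_))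
  simp [Circle.norm_coe (γ x)]

lemma fourierTransform_characterMap_self (γ : PontryaginDual G) :
    fourierTransform (characterMap γ) γ = 1 := by
  have : ∀ x, conj (γ x : ℂ) * characterMap γ x = 1 := fun x => by
    rw [characterMap_apply, Complex.conj_mul', Circle.norm_coe]; norm_num
  simp [fourierTransform, this]

/-- The integrand `F` is multiplicative, so invariance gives `∫ F = F g * ∫ F` with `F g ≠ 1` for a
suitable `g`. -/
lemma fourierTransform_characterMap_of_ne {γ γ' : PontryaginDual G} (h : γ ≠ γ') :
    fourierTransform (characterMap γ') γ = 0 := by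
  obtain ⟨g, hg⟩ : ∃ g, γ g ≠ γ' g := by
    by_contra! h'
    exact h (PontryaginDual.ext h')
  let F : G → ℂ := fun x => conj (γ x : ℂ) * characterMap γ' x
  have h1 : ∀ x, F (g * x) = F g * F x := fun x => by
    simp only [F, characterMap_apply, map_mul, Circle.coe_mul]; ring
  have h2 := integral_mul_left_eq_self (μ := normalizedHaar G) F g
  simp only [h1, integral_const_mul] at h2
  have h3 : F g ≠ 1 := by
    intro h4
    have h5 : (γ g : ℂ) * F g = γ' g := by
      simp only [F, characterMap_apply]
      rw [← mul_assoc, Complex.mul_conj', Circle.norm_coe]; norm_num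
    rw [h4, mul_one] at h5
    exact hg (Circle.ext h5)
  change ∫ x, F x ∂(normalizedHaar G) = 0
  have h6 : (F g - 1) * ∫ x, F x ∂(normalizedHaar G) = 0 := by rw [sub_mul, h2, one_mul, sub_self]
  exact (mul_eq_zero.1 h6).resolve_left (sub_ne_zero.2 h3)

/-- The Fourier coefficient at `γ` as a functional on `C(G)`. -/
def fourierCoeffC (γ : PontryaginDual G) : C(G, ℂ) →L[ℂ] ℂ :=
  LinearMap.mkContinuous
    { toFun := fun f => fourierTransform f γ
      map_add' := fun f g =>
        fourierTransform_add f.integrable_normalizedHaar g.integrable_normalizedHaar γ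
      map_smul' := fun c f => fourierTransform_smul c f γ } 1 fun f => by
    refine (norm_fourierTransform_le f γ).trans ?_
    refine (integral_mono f.integrable_normalizedHaar.norm (integrable_const ‖f‖)
      f.norm_coe_le_norm).trans_eq ?_
    simp

/-- The Fourier coefficient at `γ` as a functional on `L¹(G)`. -/
def fourierCoeffL (γ : PontryaginDual G) : Lp ℂ 1 (normalizedHaar G) →L[ℂ] ℂ :=
  LinearMap.mkContinuous
    { toFun := fun f => fourierTransform f γ
      map_add' := fun f g => by
        rw [fourierTransform_congr (Lp.coeFn_add f g),
          fourierTransform_add (L1.integrable_coeFn f) (L1.integrable_coeFn g)]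
      map_smul' := fun c f => by
        rw [fourierTransform_congr (Lp.coeFn_smul c f), fourierTransform_smul]; rfl } 1 fun f => by
    refine (norm_fourierTransform_le f γ).trans_eq ?_
    rw [one_mul, L1.norm_eq_integral_norm]

lemma fourierCoeffC_apply (γ : PontryaginDual G) (f : C(G, ℂ)) :
    fourierCoeffC γ f = fourierTransform f γ := rfl

lemma fourierCoeffL_apply (γ : PontryaginDual G) (f : Lp ℂ 1 (normalizedHaar G)) :
    fourierCoeffL γ f = fourierTransform f γ := rfl

lemma finite_fourierSpec_of_mem_trigPolynomial {f : C(G, ℂ)} (hf : f ∈ trigPolynomial G) :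
    (fourierSpec f).Finite := by
  rw [mem_trigPolynomial] at hf
  induction hf using Submodule.span_induction with
  | mem f hf =>
    obtain ⟨γ, rfl⟩ := hf
    refine (Set.finite_singleton γ).subset fun γ' h => ?_
    by_contra h'
    exact h (fourierTransform_characterMap_of_ne h')
  | zero => rw [ContinuousMap.coe_zero, fourierSpec_zero]; exact Set.finite_empty
  | add f g _ _ hf hg =>
    exact (hf.union hg).subset
      (fourierSpec_add f.integrable_normalizedHaar g.integrable_normalizedHaar)
  | smul c f _ hf => exact hf.subset (fourierSpec_smul c f)

instance : CompactSpace (characterKernel G) :=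
  isCompact_iff_compactSpace.1 isClosed_characterKernel.isCompact

/-- The average of a continuous function over the cosets of the common kernel of all characters. -/
def kernelAverage (f : C(G, ℂ)) : C(G, ℂ) where
  toFun x := ∫ h : characterKernel G, f (x * h) ∂(normalizedHaar (characterKernel G))
  continuous_toFun := by
    -- Currying makes `x ↦ f (x * ·)` continuous in the supremum norm. Averaging is the bounded
    -- functional given by the coefficient at the trivial character.
    let F : C(G, C(characterKernel G, ℂ)) :=
      (f.comp ⟨fun p : G × characterKernel G => p.1 * (p.2 : G), by fun_prop⟩).curry
    exact (fourierCoeffC (1 : PontryaginDual (characterKernel G))).continuous.comp F.continuous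
      |>.congr fun x => by
        simp [fourierCoeffC_apply, fourierTransform, F]

lemma kernelAverage_apply (f : C(G, ℂ)) (x : G) : kernelAverage f x =
    ∫ h : characterKernel G, f (x * h) ∂(normalizedHaar (characterKernel G)) := rfl

lemma kernelAverage_mul_right (f : C(G, ℂ)) (x : G) {k : G} (hk : k ∈ characterKernel G) :
    kernelAverage f (x * k) = kernelAverage f x := by
  rw [kernelAverage_apply, kernelAverage_apply, ← integral_mul_left_eq_self
    (fun h : characterKernel G => f (x * h)) (⟨k, hk⟩ : characterKernel G)]
  simp [mul_assoc]

/-- Swap the integrals and translate by `h`, where `γ h = 1`. -/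
lemma fourierTransform_kernelAverage (f : C(G, ℂ)) (γ : PontryaginDual G) :
    fourierTransform (kernelAverage f) γ = fourierTransform f γ := by
  simp only [fourierTransform, kernelAverage_apply, ← integral_const_mul]
  have hc : Continuous fun x : G => (γ x : ℂ) := (characterMap γ).continuous
  -- `G` may fail to be second countable, so Fubini is used in its form for continuous, compactly
  -- supported functions.
  rw [integral_integral_swap_of_hasCompactSupport
    (f := fun (x : G) (h : characterKernel G) => conj (γ x : ℂ) * f (x * h))
    (by
      have h1 : Continuous fun p : G × characterKernel G => conj (γ p.1 : ℂ) :=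
        Complex.continuous_conj.comp (hc.comp continuous_fst)
      exact h1.mul (f.continuous.comp (by fun_prop)))
    (HasCompactSupport.of_compactSpace _)]
  have h2 : ∀ h : characterKernel G, ∫ x, conj (γ x : ℂ) * f (x * h) ∂(normalizedHaar G) =
      ∫ x, conj (γ x : ℂ) * f x ∂(normalizedHaar G) := fun h => by
    rw [← integral_mul_right_eq_self (fun x => conj (γ x : ℂ) * f x) (h : G)]
    simp [mem_characterKernel.1 h.2 γ]
  simp [h2]

/-- `f - kernelAverage f` has zero Fourier transform, so adding to it a trigonometric polynomial
near `kernelAverage f` approximates `f` with finite spectrum. -/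
lemma dense_finite_fourierSpec : Dense {f : C(G, ℂ) | (fourierSpec f).Finite} := by
  intro f
  have h1 := mem_closure_trigPolynomial (g := kernelAverage f) fun x h hh =>
    kernelAverage_mul_right f x hh
  have h2 : (f - kernelAverage f) + kernelAverage f ∈
      closure {f : C(G, ℂ) | (fourierSpec f).Finite} := by
    refine map_mem_closure (continuous_const.add continuous_id) h1 fun p hp => ?_
    refine (finite_fourierSpec_of_mem_trigPolynomial hp).subset fun γ hγ h0 => hγ ?_
    change fourierCoeffC γ (f - kernelAverage f + p) = 0
    rw [map_add, map_sub, fourierCoeffC_apply, fourierCoeffC_apply, fourierCoeffC_apply,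
      fourierTransform_kernelAverage, sub_self, zero_add, h0]
  rwa [sub_add_cancel] at h2

lemma continuousWithSpec_eq_vanishingOutside (Λ : Set (PontryaginDual G)) :
    continuousWithSpec Λ = vanishingOutside fourierCoeffC Λ := by
  ext f
  change (∀ γ, fourierTransform f γ ≠ 0 → γ ∈ Λ) ↔ ∀ γ, γ ∉ Λ → fourierTransform f γ = 0
  exact forall_congr' fun γ => not_imp_comm

lemma lOneWithSpec_eq_vanishingOutside (Λ : Set (PontryaginDual G)) :
    lOneWithSpec Λ = vanishingOutside fourierCoeffL Λ := by
  ext f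
  change (∀ γ, fourierTransform f γ ≠ 0 → γ ∈ Λ) ↔ ∀ γ, γ ∉ Λ → fourierTransform f γ = 0
  exact forall_congr' fun γ => not_imp_comm

lemma fourierTransform_toLp (f : C(G, ℂ)) (γ : PontryaginDual G) :
    fourierTransform (ContinuousMap.toLp 1 (normalizedHaar G) ℂ f) γ = fourierTransform f γ :=
  fourierTransform_congr (ContinuousMap.coeFn_toLp (normalizedHaar G) f) γ

lemma norm_toLp_one_le (f : C(G, ℂ)) :
    ‖ContinuousMap.toLp 1 (normalizedHaar G) ℂ f‖ ≤ ‖f‖ := by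
  rw [L1.norm_eq_integral_norm, integral_congr_ae
    ((ContinuousMap.coeFn_toLp (𝕜 := ℂ) (p := 1) (normalizedHaar G) f).mono
      fun x hx => congrArg norm hx)]
  refine (integral_mono f.integrable_normalizedHaar.norm (integrable_const ‖f‖)
    f.norm_coe_le_norm).trans_eq ?_
  simp

end FourierCoefficients

/-! ### The two cases. -/

theorem mainTheorem10 {G : Type*} [CommGroup G] [TopologicalSpace G] [IsTopologicalGroup G]
    [CompactSpace G] [T2Space G] [Infinite G] [MeasurableSpace G] [BorelSpace G]
    (Λ : Set (PontryaginDual G)) :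
    ((∀ Θ : Set (PontryaginDual G), Λ ⊆ Θ → HasDaugavetProperty ℂ (continuousWithSpec Θ)) →
      IsRich (continuousWithSpec Λ)) ∧
    ((∀ Θ : Set (PontryaginDual G), Λ ⊆ Θ → HasDaugavetProperty ℂ (lOneWithSpec Θ)) →
      IsRich (lOneWithSpec Λ)) := by
  rw [funext continuousWithSpec_eq_vanishingOutside, funext lOneWithSpec_eq_vanishingOutside]
  refine ⟨isRich_vanishingOutside fourierCoeffC characterMap norm_characterMap_le
      fourierTransform_characterMap_self (fun _ _ => fourierTransform_characterMap_of_ne)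
      dense_finite_fourierSpec Λ,
    isRich_vanishingOutside fourierCoeffL
      (fun γ => ContinuousMap.toLp 1 (normalizedHaar G) ℂ (characterMap γ))
      (fun γ => (norm_toLp_one_le _).trans (norm_characterMap_le γ))
      (fun γ => (fourierTransform_toLp _ γ).trans (fourierTransform_characterMap_self γ))
      (fun γ γ' h => (fourierTransform_toLp _ γ).trans (fourierTransform_characterMap_of_ne h))
      ?_ Λ⟩
  -- `C(G)` is dense in `L¹(G)` and the embedding keeps Fourier coefficients, so density of finite
  -- spectrum carries over.
  refine ((ContinuousMap.toLp_denseRange ℂ (normalizedHaar G) ℂ ENNReal.one_ne_top).dense_image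
    (ContinuousMap.toLp 1 (normalizedHaar G) ℂ).continuous dense_finite_fourierSpec).mono ?_
  rintro _ ⟨f, hf, rfl⟩
  refine Set.Finite.subset hf fun γ hγ h0 => hγ ?_
  rw [fourierCoeffL_apply, fourierTransform_toLp, h0]
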